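/- All rings are commutative, local rings are Noetherian, and a local ring is called singular if it is not regular. A local ring $R$ is called Tor-friendly if, for every pair $(M,N)$ of finitely generated $R$-modules such that $\operatorname{Tor}_i^R(M,N)=0$ for all $i\gg 0$, at least one of $M$ and $N$ has finite projective dimension over $R$. Proposition 3.3. Let $P$ be a regular local ring, and let $Q$ and $Q'$ be (nonzero) quotient rings of $P$ that are singular local rings. If $\operatorname{Tor}_i^P(Q,Q')=0$ for all $i\ge 1$, then the ring $R=Q\otimes_P Q'$ is not Tor-friendly. -/

import Mathlib

universe u

open CategoryTheory

/-- A commutative ring `R` is Tor-friendly if, for all finite `R`-modules `M` and `N`, vanishing of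
`Tor_i^R(M, N)` for all `i ≫ 0` implies that `M` or `N` has finite projective dimension.
The projective dimension takes values in `WithBot ℕ∞`: it is `⊤` exactly when it is infinite, and
`⊥` for the zero module (which counts as finite). Since finite `R`-modules are `u`-small, testing
modules in the universe of `R` loses nothing. -/
def IsTorFriendly (R : Type u) [CommRing R] : Prop :=
  ∀ (M N : Type u) [AddCommGroup M] [Module R M] [Module.Finite R M]
    [AddCommGroup N] [Module R N] [Module.Finite R N],
    (∃ n : ℕ, ∀ i : ℕ, n ≤ i →
      Limits.IsZero (((Tor (ModuleCat.{u} R) i).obj (ModuleCat.of R M)).obj (ModuleCat.of R N))) →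
    projectiveDimension (ModuleCat.of R M) < ⊤ ∨ projectiveDimension (ModuleCat.of R N) < ⊤

open IsLocalRing Module TensorProduct

/-! Write A = Q', B = Q, R = A ⊗_P B. The modules that refute Tor-friendliness are M = R ⊗_A X and N
= R ⊗_B Y, where X and Y are high syzygies of the residue fields of A and of B.

Finite P-modules have finite projective dimension
(`IsRegularLocalRing.exists_hasProjectiveDimensionLE`), and Tor^P_i(A, B) = 0 for i > 0 allows
dimension shifting along A-free and B-free resolutions. Hence, far enough out, Tor^P_i vanishes for
i > 0 on the pairs (X, B), (A, Y) and (X, Y). On A-modules R ⊗_A - is B ⊗_P -, and symmetrically for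
B, so the first two vanishings keep the free resolutions of X and Y exact over R. Since M ⊗_R N = X
⊗_P Y, the third gives Tor^R_i(M, N) = 0 for i > 0 (`torVanishesAbove_baseChange`).

If M had finite projective dimension, so would X, by descent along the local map A → R
(`SyzygySequence.hasProjectiveDimensionLE_of_baseChange`), hence so would the residue field of A.
Then A would be regular (`IsRegularLocalRing.of_hasProjectiveDimensionLE_residueField`). The same
argument applies to N and B.

Vanishing of Tor is handled as vanishing of Ext into character modules, which makes the long exact
sequences of Ext available in both variables. -/

lemma IsLocalRing.nontrivial_quotient_span_singleton {A : Type u} [CommRing A]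
    [IsLocalRing A] {x : A} (hx : x ∈ maximalIdeal A) :
    Nontrivial (A ⧸ Ideal.span {x}) :=
  Ideal.Quotient.nontrivial_iff.mpr fun h ↦ (maximalIdeal.isMaximal A).ne_top
    (top_le_iff.mp (h ▸ (Ideal.span_singleton_le_iff_mem _).mpr hx))

lemma IsLocalRing.quotient_span_singleton {A : Type u} [CommRing A]
    [IsLocalRing A] {x : A} (hx : x ∈ maximalIdeal A) :
    IsLocalRing (A ⧸ Ideal.span {x}) :=
  have := nontrivial_quotient_span_singleton hx
  IsLocalRing.of_surjective' _ Ideal.Quotient.mk_surjective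

/-! ### Projective dimension, syzygies and reduction modulo a regular element -/

section ProjectiveDimension

variable {A : Type u} [CommRing A]

lemma hasProjectiveDimensionLE_zero_iff_projective (M : Type u) [AddCommGroup M] [Module A M] :
    HasProjectiveDimensionLE (ModuleCat.of A M) 0 ↔ Module.Projective A M := by
  rw [← projective_iff_hasProjectiveDimensionLE_zero, ← IsProjective.iff_projective]

lemma hasProjectiveDimensionLE_of_equiv {M N : Type u} [AddCommGroup M] [Module A M]
    [AddCommGroup N] [Module A N] (e : M ≃ₗ[A] N) (n : ℕ) :
    HasProjectiveDimensionLE (ModuleCat.of A M) n ↔ HasProjectiveDimensionLE (ModuleCat.of A N) n :=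
  ⟨fun _ ↦ hasProjectiveDimensionLT_of_iso e.toModuleIso _,
    fun _ ↦ hasProjectiveDimensionLT_of_iso e.symm.toModuleIso _⟩

lemma shortExact_of_exact {K F M : Type u} [AddCommGroup K] [Module A K] [AddCommGroup F]
    [Module A F] [AddCommGroup M] [Module A M] {i : K →ₗ[A] F} {g : F →ₗ[A] M}
    (hi : Function.Injective i) (hg : Function.Surjective g) (h : Function.Exact i g) :
    (ShortComplex.mk (ModuleCat.ofHom i) (ModuleCat.ofHom g)
      (by ext x; exact h.apply_apply_eq_zero x)).ShortExact where
  exact := by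
    rw [ShortComplex.ShortExact.moduleCat_exact_iff_function_exact]
    exact h
  mono_f := (ModuleCat.mono_iff_injective _).mpr hi
  epi_g := (ModuleCat.epi_iff_surjective _).mpr hg

lemma hasProjectiveDimensionLE_succ_iff_of_exact {K F M : Type u} [AddCommGroup K] [Module A K]
    [AddCommGroup F] [Module A F] [AddCommGroup M] [Module A M] {i : K →ₗ[A] F} {g : F →ₗ[A] M}
    (hi : Function.Injective i) (hg : Function.Surjective g) (h : Function.Exact i g)
    [Module.Projective A F] (n : ℕ) :
    HasProjectiveDimensionLE (ModuleCat.of A M) (n + 1) ↔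
      HasProjectiveDimensionLE (ModuleCat.of A K) n :=
  (shortExact_of_exact hi hg h).hasProjectiveDimensionLT_X₃_iff n
    ((IsProjective.iff_projective F).mp inferInstance)

lemma hasProjectiveDimensionLE_succ_iff {F M : Type u}
    [AddCommGroup F] [Module A F] [AddCommGroup M] [Module A M] {g : F →ₗ[A] M}
    (hg : Function.Surjective g) [Module.Projective A F] (n : ℕ) :
    HasProjectiveDimensionLE (ModuleCat.of A M) (n + 1) ↔
      HasProjectiveDimensionLE (ModuleCat.of A (LinearMap.ker g)) n :=
  hasProjectiveDimensionLE_succ_iff_of_exact (Submodule.subtype_injective _) hg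
    (LinearMap.exact_subtype_ker_map g) n

variable [IsLocalRing A] [IsNoetherianRing A]

/-- Reduction modulo a regular element preserves projective dimension. -/
lemma hasProjectiveDimensionLE_quotSMulTop_iff {x : A} (hx : x ∈ maximalIdeal A)
    (hxA : IsSMulRegular A x) (M : Type u) [AddCommGroup M] [Module A M] [Module.Finite A M]
    (hxM : IsSMulRegular M x) (n : ℕ) :
    HasProjectiveDimensionLE (ModuleCat.of (A ⧸ Ideal.span {x}) (QuotSMulTop x M)) n ↔
      HasProjectiveDimensionLE (ModuleCat.of A M) n := by
  have := IsLocalRing.quotient_span_singleton hx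
  induction n generalizing M with
  | zero =>
    have := Module.finitePresentation_of_finite A M
    have : Module.Finite (A ⧸ Ideal.span {x}) (QuotSMulTop x M) :=
      Module.Finite.of_restrictScalars_finite A _ _
    rw [hasProjectiveDimensionLE_zero_iff_projective, hasProjectiveDimensionLE_zero_iff_projective]
    have key := Module.free_quotSMulTop_iff_free A M (x := x)
      (by rwa [IsLocalRing.jacobson_eq_maximalIdeal _ bot_ne_top]) hxM
    exact ⟨fun h ↦ have := key.mp Module.free_of_flat_of_isLocalRing; inferInstance,
      fun h ↦ have := key.mpr Module.free_of_flat_of_isLocalRing; inferInstance⟩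
  | succ n ih =>
    obtain ⟨k, f, hf⟩ := Module.Finite.exists_fin' A M
    have hK : IsSMulRegular (LinearMap.ker f) x :=
      IsSMulRegular.submodule _ _ (IsSMulRegular.pi fun _ ↦ hxA)
    have hsurj := Ideal.Quotient.mk_surjective (I := Ideal.span {x})
    let i' := (QuotSMulTop.map x (LinearMap.ker f).subtype)
    let g' := (QuotSMulTop.map x f)
    have hex : Function.Exact i' g' :=
      QuotSMulTop.map_exact x (LinearMap.exact_subtype_ker_map f) hf
    -- Injectivity survives reduction because `x` is regular on `M`; the zero map from `PUnit`
    -- completes a four-term exact sequence.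
    have hinj : Function.Injective i' := by
      have := QuotSMulTop.map_first_exact_on_four_term_exact_of_isSMulRegular_last
        (f₁ := (0 : PUnit →ₗ[A] LinearMap.ker f)) (r := x)
        (by intro y; simp [eq_comm]) (LinearMap.exact_subtype_ker_map f) hxM
      rw [injective_iff_map_eq_zero]
      intro a ha
      obtain ⟨b, rfl⟩ := (this a).mp ha
      obtain ⟨b, rfl⟩ := Submodule.mkQ_surjective _ b
      simp
    refine Iff.trans ?_ ((ih (LinearMap.ker f) hK).trans
      (hasProjectiveDimensionLE_succ_iff hf n).symm)
    exact hasProjectiveDimensionLE_succ_iff_of_exact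
      (i := i'.extendScalarsOfSurjective hsurj) (g := g'.extendScalarsOfSurjective hsurj)
      hinj (QuotSMulTop.map_surjective x hf) hex n

end ProjectiveDimension

/-! ### Embedding dimension of a quotient by one element -/

section QuotientByElement

variable {A : Type u} [CommRing A] [IsLocalRing A]

variable [IsNoetherianRing A]

/-- Some member of a minimal generating set occurs in `x` with a unit coefficient, so it becomes
redundant modulo `x`. -/
lemma IsLocalRing.spanFinrank_maximalIdeal_quotient_add_one_le {x : A} (hx : x ∈ maximalIdeal A)
    (hx2 : x ∉ maximalIdeal A ^ 2) [IsLocalRing (A ⧸ Ideal.span {x})] :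
    (maximalIdeal (A ⧸ Ideal.span {x})).spanFinrank + 1 ≤ (maximalIdeal A).spanFinrank := by
  classical
  obtain ⟨s, hs, hspan⟩ :=
    Submodule.FG.exists_span_finset_card_eq_spanFinrank (maximalIdeal A).fg_of_isNoetherianRing
  have hsm : ∀ y ∈ s, y ∈ maximalIdeal A := fun y hy ↦ hspan ▸ Submodule.subset_span hy
  obtain ⟨a, ha, hax⟩ := (Submodule.mem_span_finset (R := A)).mp (hspan.symm ▸ hx)
  obtain ⟨y, hy, hay⟩ : ∃ y ∈ s, a y ∉ maximalIdeal A := by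
    by_contra! h
    refine hx2 (hax ▸ Ideal.sum_mem _ fun y hy ↦ ?_)
    rw [pow_two]
    exact Ideal.mul_mem_mul (h y hy) (hsm y hy)
  have hunit : IsUnit (a y) := by simpa using hay
  let π := Ideal.Quotient.mk (Ideal.span {x})
  have hspan' : maximalIdeal (A ⧸ Ideal.span {x}) =
      Ideal.span (((s.erase y).image π : Finset _) : Set _) := by
    rw [← map_maximalIdeal_of_surjective π Ideal.Quotient.mk_surjective]
    refine le_antisymm ?_ ?_
    · rw [← hspan, Ideal.submodule_span_eq, Ideal.map_span, Ideal.span_le]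
      rintro _ ⟨z, hz, rfl⟩
      have hmem : ∀ z ∈ s.erase y, π z ∈ Ideal.span (((s.erase y).image π : Finset _) : Set _) :=
        fun z hz ↦ Ideal.subset_span (Finset.mem_image_of_mem π hz)
      by_cases hzy : z = y
      · subst hzy
        have h0 : π x = 0 := Ideal.Quotient.eq_zero_iff_mem.mpr (Ideal.mem_span_singleton_self x)
        replace h0 := (congrArg π ((Finset.add_sum_erase _ _ hy).trans hax)).trans h0
        rw [map_add, smul_eq_mul, map_mul] at h0
        have : π (a z) * π z ∈ Ideal.span (((s.erase z).image π : Finset _) : Set _) := by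
          rw [eq_neg_of_add_eq_zero_left h0, neg_mem_iff, map_sum]
          refine Ideal.sum_mem _ fun w hw ↦ ?_
          rw [smul_eq_mul, map_mul]
          exact Ideal.mul_mem_left _ _ (hmem w hw)
        exact (Ideal.unit_mul_mem_iff_mem _ (hunit.map π)).mp this
      · exact hmem z (by simp_all)
    · rw [Ideal.span_le]
      intro w hw
      obtain ⟨z, hz, rfl⟩ := by simpa only [Finset.coe_image] using hw
      exact Ideal.mem_map_of_mem π (hsm z (Finset.mem_of_mem_erase hz))
  have hle : (maximalIdeal (A ⧸ Ideal.span {x})).spanFinrank ≤ (s.erase y).card := by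
    rw [hspan']
    refine (Submodule.spanFinrank_span_le_ncard_of_finite (Finset.finite_toSet _)).trans ?_
    rw [Set.ncard_coe_finset]
    exact Finset.card_image_le
  have := Finset.card_erase_add_one hy
  omega

lemma IsLocalRing.spanFinrank_maximalIdeal_le_quotient_add_one {x : A} (hx : x ∈ maximalIdeal A)
    [IsLocalRing (A ⧸ Ideal.span {x})] :
    (maximalIdeal A).spanFinrank ≤ (maximalIdeal (A ⧸ Ideal.span {x})).spanFinrank + 1 := by
  classical
  obtain ⟨s, hs, hspan⟩ :=
    Submodule.FG.exists_span_finset_card_eq_spanFinrank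
      (maximalIdeal (A ⧸ Ideal.span {x})).fg_of_isNoetherianRing
  let π := Ideal.Quotient.mk (Ideal.span {x})
  have hπ : Function.Surjective π := Ideal.Quotient.mk_surjective
  let t : Finset A := insert x (s.image (Function.surjInv hπ))
  have ht : maximalIdeal A = Ideal.span (t : Set A) := by
    have hmap : (Ideal.span (t : Set A)).map π = maximalIdeal (A ⧸ Ideal.span {x}) := by
      have h0 : π x = 0 := Ideal.Quotient.eq_zero_iff_mem.mpr (Ideal.mem_span_singleton_self x)
      rw [Ideal.map_span, ← hspan, Finset.coe_insert, Set.image_insert_eq, h0, Finset.coe_image,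
        Set.image_image]
      simp [Function.surjInv_eq, Submodule.span_insert_zero]
    have hker : Ideal.comap π ⊥ ≤ Ideal.span (t : Set A) := by
      rw [← RingHom.ker_eq_comap_bot, Ideal.mk_ker, Ideal.span_singleton_le_iff_mem]
      exact Ideal.subset_span (by simp [t])
    rw [← sup_eq_left.mpr hker, ← Ideal.comap_map_of_surjective π hπ, hmap,
      ← map_maximalIdeal_of_surjective π hπ, Ideal.comap_map_of_surjective π hπ,
      eq_comm, sup_eq_left, ← RingHom.ker_eq_comap_bot, Ideal.mk_ker,
      Ideal.span_singleton_le_iff_mem]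
    exact hx
  rw [ht]
  refine (Submodule.spanFinrank_span_le_ncard_of_finite (Finset.finite_toSet _)).trans ?_
  rw [Set.ncard_coe_finset]
  have hcard := Finset.card_image_le (s := s) (f := Function.surjInv hπ)
  exact (Finset.card_insert_le _ _).trans (by omega)

/-- Prime avoidance: outside `m ^ 2` and finitely many non-maximal primes. -/
lemma IsLocalRing.exists_mem_notMem_sq_notMem_primes (h : maximalIdeal A ≠ ⊥) {S : Set (Ideal A)}
    (hfin : S.Finite) (hprime : ∀ p ∈ S, p.IsPrime) (hS : maximalIdeal A ∉ S) :
    ∃ x ∈ maximalIdeal A, x ∉ maximalIdeal A ^ 2 ∧ ∀ p ∈ S, x ∉ p := by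
  have hsq : ¬ maximalIdeal A ≤ maximalIdeal A ^ 2 := by
    intro hle
    refine h (Submodule.eq_bot_of_le_smul_of_le_jacobson_bot (maximalIdeal A) _
      (maximalIdeal A).fg_of_isNoetherianRing ?_ (maximalIdeal_le_jacobson _))
    rwa [smul_eq_mul, ← pow_two]
  by_contra! hcon
  -- Prime avoidance tolerates two ideals that need not be prime; `maximalIdeal A ^ 2` fills both
  -- slots.
  have := (Ideal.subset_union_prime_finite (hfin.insert (maximalIdeal A ^ 2)) (f := id)
    (maximalIdeal A ^ 2) (maximalIdeal A ^ 2) (I := maximalIdeal A)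
    (fun p hp hne _ ↦ hprime p (hp.resolve_left hne))).mp (by
      intro x hx
      by_cases hx2 : x ∈ maximalIdeal A ^ 2
      · exact Set.mem_biUnion (Set.mem_insert _ _) hx2
      · obtain ⟨p, hp, hxp⟩ := hcon x hx hx2
        exact Set.mem_biUnion (Set.mem_insert_of_mem _ hp) hxp)
  obtain ⟨p, rfl | hp, hle⟩ := this
  · exact hsq hle
  · exact hS ((maximalIdeal.isMaximal A).eq_of_le (hprime p hp).ne_top hle ▸ hp)

end QuotientByElement

/-! ### Regular local rings: domains of finite global dimension -/

section Regular

lemma IsLocalRing.spanFinrank_maximalIdeal_eq_zero_iff {A : Type u} [CommRing A] [IsLocalRing A]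
    [IsNoetherianRing A] : (maximalIdeal A).spanFinrank = 0 ↔ maximalIdeal A = ⊥ :=
  Submodule.spanFinrank_eq_zero_iff_eq_bot (maximalIdeal A).fg_of_isNoetherianRing

lemma IsRegularLocalRing.of_maximalIdeal_eq_bot {A : Type u} [CommRing A] [IsLocalRing A]
    [IsNoetherianRing A] (h : maximalIdeal A = ⊥) : IsRegularLocalRing A := by
  refine .of_spanFinrank_maximalIdeal_le _ ?_
  rw [spanFinrank_maximalIdeal_eq_zero_iff.mpr h]
  exact ringKrullDim_nonneg_of_nontrivial

/-- The embedding dimension drops by at least one, the Krull dimension by at most one. -/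
lemma IsRegularLocalRing.quotient_span_singleton {A : Type u} [CommRing A] [IsRegularLocalRing A]
    {x : A} (hx : x ∈ maximalIdeal A) (hx2 : x ∉ maximalIdeal A ^ 2) :
    IsRegularLocalRing (A ⧸ Ideal.span {x}) := by
  have := IsLocalRing.quotient_span_singleton hx
  refine .of_spanFinrank_maximalIdeal_le _ ?_
  have h1 := spanFinrank_maximalIdeal_quotient_add_one_le hx hx2
  have h2 := ringKrullDim_le_ringKrullDim_quotient_add_card (R := A) {x} (by
    rw [IsLocalRing.ringJacobson_eq_maximalIdeal]; simpa using hx)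
  rw [Finset.coe_singleton, Finset.card_singleton, ← (isRegularLocalRing_iff A).mp ‹_›] at h2
  refine (ENat.WithBot.add_le_add_natCast_right_iff (c := 1)).mp (le_trans ?_ h2)
  exact_mod_cast h1

lemma IsRegularLocalRing.maximalIdeal_notMem_minimalPrimes {A : Type u} [CommRing A]
    [IsRegularLocalRing A] (h : maximalIdeal A ≠ ⊥) : maximalIdeal A ∉ minimalPrimes A := by
  intro hmin
  have h0 := Ideal.height_eq_zero_iff.mpr hmin
  have h1 := IsLocalRing.maximalIdeal_height_eq_ringKrullDim (R := A)
  rw [h0, ← (isRegularLocalRing_iff A).mp ‹_›] at h1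
  refine h (spanFinrank_maximalIdeal_eq_zero_iff.mp ?_)
  exact_mod_cast h1.symm

lemma IsRegularLocalRing.exists_mem_notMem_sq {A : Type u} [CommRing A]
    [IsRegularLocalRing A] (h : maximalIdeal A ≠ ⊥) :
    ∃ x ∈ maximalIdeal A, x ∉ maximalIdeal A ^ 2 ∧ ∀ p ∈ minimalPrimes A, x ∉ p :=
  exists_mem_notMem_sq_notMem_primes h (Ideal.finite_minimalPrimes_of_isNoetherianRing A ⊥)
    (fun _ hp ↦ hp.1.1) (maximalIdeal_notMem_minimalPrimes h)

/-- For suitable `x`, the ideal (x) is prime by induction and `x` avoids all minimal primes. A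
minimal prime q ⊆ (x) then satisfies q = xq, so q = 0 by Nakayama. -/
lemma IsRegularLocalRing.isDomain (A : Type u) [CommRing A] [IsRegularLocalRing A] :
    IsDomain A := by
  induction h : (maximalIdeal A).spanFinrank using Nat.strong_induction_on generalizing A with
  | _ n ih =>
    by_cases hm : maximalIdeal A = ⊥
    · have : (⊥ : Ideal A).IsPrime := hm ▸ inferInstance
      exact IsDomain.of_bot_isPrime A
    obtain ⟨x, hx, hx2, hxp⟩ := exists_mem_notMem_sq hm
    have := quotient_span_singleton hx hx2
    have hd := ih _ (by have := spanFinrank_maximalIdeal_quotient_add_one_le hx hx2; omega)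
      (A ⧸ Ideal.span {x}) rfl
    have hp : (Ideal.span {x}).IsPrime := Ideal.Quotient.isDomain_iff_prime _ |>.mp hd
    obtain ⟨q, hq, hqx⟩ := Ideal.exists_minimalPrimes_le (bot_le : ⊥ ≤ Ideal.span {x})
    have hqp : q.IsPrime := hq.1.1
    have hq0 : q = ⊥ := by
      refine Submodule.eq_bot_of_le_smul_of_le_jacobson_bot (Ideal.span {x}) q
        q.fg_of_isNoetherianRing (fun y hy ↦ ?_) (le_trans ?_ (maximalIdeal_le_jacobson _))
      · obtain ⟨a, rfl⟩ := Ideal.mem_span_singleton'.mp (hqx hy)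
        rw [mul_comm]
        exact Ideal.mul_mem_mul (Ideal.mem_span_singleton_self x)
          ((hqp.mem_or_mem hy).resolve_right (hxp q hq))
      · exact (Ideal.span_singleton_le_iff_mem _).mpr hx
    subst hq0
    exact IsDomain.of_bot_isPrime A

/-- Finite modules over a regular local ring have finite projective dimension. -/
theorem IsRegularLocalRing.exists_hasProjectiveDimensionLE (A : Type u) [CommRing A]
    [IsRegularLocalRing A] (M : Type u) [AddCommGroup M] [Module A M] [Module.Finite A M] :
    ∃ n, HasProjectiveDimensionLE (ModuleCat.of A M) n := by
  induction h : (maximalIdeal A).spanFinrank using Nat.strong_induction_on generalizing A M with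
  | _ n ih =>
    by_cases hm : maximalIdeal A = ⊥
    · let := (isField_iff_maximalIdeal_eq.mpr hm).toField
      exact ⟨0, (hasProjectiveDimensionLE_zero_iff_projective M).mpr inferInstance⟩
    have := IsRegularLocalRing.isDomain A
    obtain ⟨x, hx, hx2, -⟩ := exists_mem_notMem_sq hm
    have hxA : IsSMulRegular A x := by
      refine IsSMulRegular.of_ne_zero ?_
      rintro rfl
      exact hx2 (zero_mem _)
    have := quotient_span_singleton hx hx2
    obtain ⟨k, f, hf⟩ := Module.Finite.exists_fin' A M
    have hK : IsSMulRegular (LinearMap.ker f) x :=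
      IsSMulRegular.submodule _ _ (IsSMulRegular.pi fun _ ↦ hxA)
    have : Module.Finite (A ⧸ Ideal.span {x}) (QuotSMulTop x (LinearMap.ker f)) :=
      Module.Finite.of_restrictScalars_finite A _ _
    obtain ⟨d, hd⟩ := ih _ (by have := spanFinrank_maximalIdeal_quotient_add_one_le hx hx2; omega)
      (A ⧸ Ideal.span {x}) (QuotSMulTop x (LinearMap.ker f)) rfl
    exact ⟨d + 1, (hasProjectiveDimensionLE_succ_iff hf d).mpr
      ((hasProjectiveDimensionLE_quotSMulTop_iff hx hxA _ hK d).mp hd)⟩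

end Regular

/-! ### Finite projective dimension of the residue field forces regularity -/

section FiniteProjectiveDimension

variable {A : Type u} [CommRing A] [IsLocalRing A] [IsNoetherianRing A]

/-- Over a local ring with nonzero socle, modules of finite projective dimension are projective. -/
lemma projective_of_hasProjectiveDimensionLE_of_socle {s : A} (hs : s ≠ 0)
    (hsm : ∀ a ∈ maximalIdeal A, s * a = 0) {n : ℕ} (M : Type u) [AddCommGroup M] [Module A M]
    [Module.Finite A M] (h : HasProjectiveDimensionLE (ModuleCat.of A M) n) :
    Module.Projective A M := by
  induction n generalizing M with
  | zero => exact (hasProjectiveDimensionLE_zero_iff_projective M).mp h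
  | succ n ih =>
    obtain ⟨k, f, hf⟩ := Module.Finite.exists_fin' A M
    have := ih (LinearMap.ker f) ((hasProjectiveDimensionLE_succ_iff hf n).mp h)
    have : Module.Free A (LinearMap.ker f) := Module.free_of_flat_of_isLocalRing
    have hsmem : ∀ c : A, s * c = 0 → c ∈ maximalIdeal A := by
      intro c hc hu
      exact hs ((IsUnit.mul_left_eq_zero hu).mp hc)
    let b := Module.Free.chooseBasis A (LinearMap.ker f)
    -- If `y` dies in k ⊗ A^k, its coordinates there lie in the maximal ideal, so `s • y = 0`. In a
    -- basis of the kernel the coefficients of `y` are then killed by `s ≠ 0`, hence are nonunits,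
    -- and `y` dies in k ⊗ ker f.
    have hinj : Function.Injective ((LinearMap.ker f).subtype.lTensor (ResidueField A)) := by
      rw [injective_iff_map_eq_zero]
      intro z hz
      obtain ⟨y, rfl⟩ := TensorProduct.mk_surjective A (LinearMap.ker f) (ResidueField A)
        residue_surjective z
      have hy : s • y = 0 := by
        ext j
        have hj := congrArg (TensorProduct.rid A _)
          (congrArg ((LinearMap.proj (R := A) (φ := fun _ : Fin k ↦ A) j).lTensor
            (ResidueField A)) hz)
        refine hsm _ ((residue_eq_zero_iff _).mp ?_)
        simpa [Algebra.smul_def] using hj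
      rw [← b.sum_repr y, TensorProduct.mk_apply, TensorProduct.tmul_sum]
      refine Finset.sum_eq_zero fun i _ ↦ ?_
      have hi : s * b.repr y i = 0 := by simpa using congrArg (fun w ↦ b.repr w i) hy
      rw [← TensorProduct.smul_tmul, Algebra.smul_def, ResidueField.algebraMap_eq,
        (residue_eq_zero_iff _).mpr (hsmem _ hi), zero_mul, TensorProduct.zero_tmul]
    obtain ⟨l, hl⟩ :=
      (IsLocalRing.split_injective_iff_lTensor_residueField_injective _).mpr hinj
    have htfae := (LinearMap.exact_subtype_ker_map f).split_tfae'
    have hl' : Function.Surjective f ∧ ∃ l, l ∘ₗ (LinearMap.ker f).subtype = LinearMap.id :=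
      ⟨hf, l, hl⟩
    obtain ⟨-, g, hg⟩ := (htfae.out 0 1).mpr hl'
    exact Module.Projective.of_split g f hg

/-- If the residue field has finite projective dimension and the maximal ideal is nonzero, then the
ring has trivial socle. -/
lemma maximalIdeal_notMem_associatedPrimes_of_hasProjectiveDimensionLE
    (hm : maximalIdeal A ≠ ⊥) {d : ℕ}
    (h : HasProjectiveDimensionLE (ModuleCat.of A (ResidueField A)) d) :
    maximalIdeal A ∉ associatedPrimes A A := by
  intro hass
  obtain ⟨-, s, hs⟩ := isAssociatedPrime_iff.mp hass
  have hsm : ∀ a ∈ maximalIdeal A, s * a = 0 := fun a ha ↦ by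
    rw [hs, Submodule.mem_colon_singleton] at ha
    simpa [mul_comm] using ha
  have hs0 : s ≠ 0 := by
    rintro rfl
    exact (maximalIdeal.isMaximal A).ne_top (by rw [hs]; ext; simp [Submodule.mem_colon_singleton])
  have := projective_of_hasProjectiveDimensionLE_of_socle hs0 hsm (ResidueField A) h
  have : Module.Free A (ResidueField A) := Module.free_of_flat_of_isLocalRing
  let b := Module.Free.chooseBasis A (ResidueField A)
  obtain ⟨i⟩ := b.index_nonempty
  refine hm (eq_bot_iff.mpr fun a ha ↦ ?_)
  have h0 : a • b i = 0 := by
    rw [Algebra.smul_def, ResidueField.algebraMap_eq, (residue_eq_zero_iff _).mpr ha, zero_mul]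
  simpa using congrArg (fun w ↦ b.repr w i) h0

/-- With m the maximal ideal, m/xm has projective dimension at most `d` over A/(x), and the residue
field is a direct summand of it: the class of `x` spans a copy, split off because `x` is nonzero in
m/m². -/
lemma hasProjectiveDimensionLE_residueField_quotient {x : A} (hx : x ∈ maximalIdeal A)
    (hx2 : x ∉ maximalIdeal A ^ 2) (hxA : IsSMulRegular A x) {d : ℕ}
    (h : HasProjectiveDimensionLE (ModuleCat.of A (ResidueField A)) d)
    [IsLocalRing (A ⧸ Ideal.span {x})] :
    HasProjectiveDimensionLE
      (ModuleCat.of (A ⧸ Ideal.span {x}) (ResidueField (A ⧸ Ideal.span {x}))) d := by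
  let B := A ⧸ Ideal.span {x}
  have hsurj : Function.Surjective (algebraMap A B) := Ideal.Quotient.mk_surjective
  have hpd : HasProjectiveDimensionLE (ModuleCat.of A (maximalIdeal A)) d := by
    -- Weakening the bound to `d + 1` avoids treating `d = 0` separately.
    have h' : HasProjectiveDimensionLE (ModuleCat.of A (ResidueField A)) (d + 1) :=
      hasProjectiveDimensionLT_of_ge _ (d + 1) (d + 2) (by omega)
    refine (hasProjectiveDimensionLE_succ_iff_of_exact (i := (maximalIdeal A).subtype)
      (g := Algebra.linearMap A (ResidueField A)) (Submodule.injective_subtype _)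
      residue_surjective ?_ d).mp h'
    intro a
    simp [ResidueField.algebraMap_eq, residue_eq_zero_iff]
  have hpdB := (hasProjectiveDimensionLE_quotSMulTop_iff hx hxA (maximalIdeal A)
    (IsSMulRegular.submodule _ _ hxA) d).mpr hpd
  have hres : ∀ a ∈ maximalIdeal A, algebraMap A (ResidueField B) a = 0 := by
    intro a ha
    rw [IsScalarTower.algebraMap_apply A B, ResidueField.algebraMap_eq, residue_eq_zero_iff,
      ← map_maximalIdeal_of_surjective _ hsurj]
    exact Ideal.mem_map_of_mem _ ha
  let ι : ResidueField B →ₗ[B] QuotSMulTop x (maximalIdeal A) :=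
    Submodule.liftQ (maximalIdeal B)
      (LinearMap.toSpanSingleton B _ (Submodule.Quotient.mk ⟨x, hx⟩)) (by
        intro c hc
        rw [← map_maximalIdeal_of_surjective _ hsurj] at hc
        obtain ⟨a, ha, rfl⟩ := (Ideal.mem_map_iff_of_surjective _ hsurj).mp hc
        rw [LinearMap.mem_ker, LinearMap.toSpanSingleton_apply, algebraMap_smul,
          ← Submodule.Quotient.mk_smul, Submodule.Quotient.mk_eq_zero]
        exact ⟨⟨a, ha⟩, trivial, Subtype.ext (mul_comm x a)⟩)
  obtain ⟨φ, hφ⟩ := Module.Projective.exists_dual_eq_one (ResidueField A)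
    (x := (maximalIdeal A).toCotangent ⟨x, hx⟩)
    (fun h0 ↦ hx2 ((Ideal.toCotangent_eq_zero _ _).mp h0))
  let ρ₀ : maximalIdeal A →ₗ[A] ResidueField B :=
    Submodule.liftQ (maximalIdeal A) (Algebra.linearMap A (ResidueField B)) hres ∘ₗ
      φ.restrictScalars A ∘ₗ (maximalIdeal A).toCotangent
  let ρ : QuotSMulTop x (maximalIdeal A) →ₗ[B] ResidueField B :=
    LinearMap.extendScalarsOfSurjective hsurj (Submodule.liftQ _ ρ₀ (by
      rintro _ ⟨y, -, rfl⟩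
      rw [LinearMap.mem_ker, DistribSMul.toLinearMap_apply, map_smul,
        ← algebraMap_smul (ResidueField B) x, hres x hx, zero_smul]))
  have hρι : ρ ∘ₗ ι = LinearMap.id := by
    have h1 : (ρ ∘ₗ ι) (residue B 1) = residue B 1 := by
      have h2 : (ρ ∘ₗ ι) (residue B 1) = ρ ((1 : B) • Submodule.Quotient.mk ⟨x, hx⟩) := rfl
      rw [h2, one_smul]
      change Submodule.liftQ (maximalIdeal A) (Algebra.linearMap A (ResidueField B)) hres
        (φ ((maximalIdeal A).toCotangent ⟨x, hx⟩)) = _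
      rw [hφ, map_one]
      exact map_one (algebraMap A (ResidueField B))
    ext c
    obtain ⟨c, rfl⟩ := residue_surjective c
    have h3 : residue B c = c • residue B 1 := by
      rw [Algebra.smul_def, ResidueField.algebraMap_eq, map_one, mul_one]
    rw [h3, map_smul, h1, LinearMap.id_apply]
  have hret : Retract (ModuleCat.of B (ResidueField B))
      (ModuleCat.of B (QuotSMulTop x (maximalIdeal A))) :=
    ⟨ModuleCat.ofHom ι, ModuleCat.ofHom ρ, by ext c; exact LinearMap.congr_fun hρι c⟩
  exact hret.hasProjectiveDimensionLT (d + 1)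

/-- A Noetherian local ring whose residue field has finite projective dimension is regular. -/
theorem IsRegularLocalRing.of_hasProjectiveDimensionLE_residueField (A : Type u) [CommRing A]
    [IsLocalRing A] [IsNoetherianRing A] {d : ℕ}
    (h : HasProjectiveDimensionLE (ModuleCat.of A (ResidueField A)) d) :
    IsRegularLocalRing A := by
  induction hn : (maximalIdeal A).spanFinrank using Nat.strong_induction_on generalizing A with
  | _ n ih =>
    by_cases hm : maximalIdeal A = ⊥
    · exact .of_maximalIdeal_eq_bot hm
    obtain ⟨x, hx, hx2, hxp⟩ := exists_mem_notMem_sq_notMem_primes hm (associatedPrimes.finite A A)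
      (fun _ hp ↦ hp.1) (maximalIdeal_notMem_associatedPrimes_of_hasProjectiveDimensionLE hm h)
    have hxA : IsSMulRegular A x := by
      by_contra hcon
      have : x ∈ ⋃ p ∈ associatedPrimes A A, (p : Set A) := by
        rw [biUnion_associatedPrimes_eq_compl_regular]
        exact hcon
      obtain ⟨p, hp, hxp'⟩ := Set.mem_iUnion₂.mp this
      exact hxp p hp hxp'
    have hloc := IsLocalRing.quotient_span_singleton hx
    have hB := ih _ (by have := spanFinrank_maximalIdeal_quotient_add_one_le hx hx2; omega)
      (A ⧸ Ideal.span {x}) (hasProjectiveDimensionLE_residueField_quotient hx hx2 hxA h) rfl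
    -- With B = A/(x) regular: edim A ≤ edim B + 1 = dim B + 1 = dim A.
    refine .of_spanFinrank_maximalIdeal_le _ ?_
    rw [← ringKrullDim_quotient_span_singleton_succ_eq_ringKrullDim hxA hx,
      ← (isRegularLocalRing_iff _).mp hB]
    exact_mod_cast spanFinrank_maximalIdeal_le_quotient_add_one hx

end FiniteProjectiveDimension

/-! ### Character modules and the duality between Tor and Ext -/

section CharacterDual

variable {A : Type u} [CommRing A]

lemma CharacterModule.exact_dual {X Y Z : Type*} [AddCommGroup X] [Module A X]
    [AddCommGroup Y] [Module A Y] [AddCommGroup Z] [Module A Z] {f : X →ₗ[A] Y} {g : Y →ₗ[A] Z}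
    (h : Function.Exact f g) : Function.Exact (dual g) (dual f) := by
  intro c
  constructor
  · intro hc
    -- `c` kills the range of `f`, which is the kernel of `g`; it descends to a quotient embedded in
    -- `Z` and extends from there.
    let c' : CharacterModule (Y ⧸ LinearMap.ker g) := QuotientAddGroup.lift _ c (by
      intro y hy
      obtain ⟨x, rfl⟩ := (h y).mp hy
      exact congr($hc x))
    obtain ⟨e, he⟩ := dual_surjective_of_injective
      ((LinearMap.ker g).liftQ g le_rfl)
      (LinearMap.ker_eq_bot.mp (Submodule.ker_liftQ_eq_bot _ _ _ le_rfl)) c'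
    refine ⟨e, ?_⟩
    ext y
    exact congr($he (Submodule.Quotient.mk y))
  · rintro ⟨e, rfl⟩
    ext x
    change e (g (f x)) = 0
    rw [h.apply_apply_eq_zero, map_zero]

lemma CharacterModule.exact_of_exact_dual {X Y Z : Type*} [AddCommGroup X] [Module A X]
    [AddCommGroup Y] [Module A Y] [AddCommGroup Z] [Module A Z] {f : X →ₗ[A] Y} {g : Y →ₗ[A] Z}
    (h : Function.Exact (dual g) (dual f)) : Function.Exact f g := by
  intro y
  constructor
  · intro hy
    have hmem : (LinearMap.range f).mkQ y = 0 := by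
      refine eq_zero_of_character_apply fun c ↦ ?_
      obtain ⟨e, he⟩ := (h (dual (LinearMap.range f).mkQ c)).mp (by
        ext x
        change c ((LinearMap.range f).mkQ (f x)) = 0
        rw [Submodule.mkQ_apply,
          (Submodule.Quotient.mk_eq_zero _).mpr (LinearMap.mem_range_self f x), map_zero])
      have hy' : e (g y) = c ((LinearMap.range f).mkQ y) := congr($he y)
      rw [← hy', hy, map_zero]
    exact (Submodule.Quotient.mk_eq_zero _).mp hmem
  · rintro ⟨x, rfl⟩
    refine eq_zero_of_character_apply fun c ↦ ?_
    exact congr($(h.apply_apply_eq_zero c) x)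

/-- Exactness after tensoring with `M` amounts to exactness of maps into `CharacterModule M`. -/
lemma exact_lTensor_iff_exact_lcomp {X Y Z : Type*} (M : Type*) [AddCommGroup M] [Module A M]
    [AddCommGroup X] [Module A X] [AddCommGroup Y] [Module A Y] [AddCommGroup Z] [Module A Z]
    {f : X →ₗ[A] Y} {g : Y →ₗ[A] Z} :
    Function.Exact (f.lTensor M) (g.lTensor M) ↔
      Function.Exact (g.lcomp A (CharacterModule M)) (f.lcomp A (CharacterModule M)) := by
  have h1 : Function.Exact (f.lTensor M) (g.lTensor M) ↔
      Function.Exact (f.rTensor M) (g.rTensor M) :=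
    Function.Exact.iff_of_ladder_linearEquiv (e₁ := TensorProduct.comm A X M)
      (e₂ := TensorProduct.comm A Y M) (e₃ := TensorProduct.comm A Z M)
      (by ext; simp) (by ext; simp)
  have h2 : Function.Exact (CharacterModule.dual (g.rTensor M))
      (CharacterModule.dual (f.rTensor M)) ↔
      Function.Exact (g.lcomp A (CharacterModule M)) (f.lcomp A (CharacterModule M)) :=
    (Function.Exact.iff_of_ladder_linearEquiv (e₁ := CharacterModule.homEquiv.symm)
      (e₂ := CharacterModule.homEquiv.symm) (e₃ := CharacterModule.homEquiv.symm) rfl rfl).symm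
  rw [h1, ← h2]
  exact ⟨CharacterModule.exact_dual, CharacterModule.exact_of_exact_dual⟩

open Abelian in
/-- `Tor_{i+1}(M, N)` is dual to `Ext^{i+1}(N, CharacterModule M)`. -/
lemma isZero_Tor_succ_iff_subsingleton_ext (M N : Type u) [AddCommGroup M] [Module A M]
    [AddCommGroup N] [Module A N] (i : ℕ) :
    Limits.IsZero (((Tor (ModuleCat.{u} A) (i + 1)).obj (ModuleCat.of A M)).obj
      (ModuleCat.of A N)) ↔
    Subsingleton (Ext (ModuleCat.of A N) (ModuleCat.of A (CharacterModule M)) (i + 1)) := by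
  -- `Tor` is derived in its second argument, so `N` is the module to resolve, as for the Ext group.
  let P := projectiveResolution (ModuleCat.of A N)
  have h1 : Limits.IsZero (((Tor (ModuleCat.{u} A) (i + 1)).obj (ModuleCat.of A M)).obj
      (ModuleCat.of A N)) ↔ Function.Exact ((P.complex.d (i + 2) (i + 1)).hom.lTensor M)
        ((P.complex.d (i + 1) i).hom.lTensor M) := by
    have e := P.isoLeftDerivedObj
      ((MonoidalCategory.tensoringLeft (ModuleCat.{u} A)).obj (ModuleCat.of A M)) (i + 1)
    refine e.isZero_iff.trans ?_
    erw [← HomologicalComplex.exactAt_iff_isZero_homology]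
    rw [HomologicalComplex.exactAt_iff' _ (i + 2) (i + 1) i (by simp) (by simp),
      ShortComplex.ShortExact.moduleCat_exact_iff_function_exact]
    rfl
  rw [h1, exact_lTensor_iff_exact_lcomp]
  constructor
  · intro h
    refine subsingleton_of_forall_eq 0 fun α ↦ ?_
    obtain ⟨φ, hφ, rfl⟩ := P.extMk_surjective α (i + 2) rfl
    rw [P.extMk_eq_zero_iff φ (i + 2) rfl hφ i rfl]
    obtain ⟨ψ, hψ⟩ := (h φ.hom).mp (congrArg ModuleCat.Hom.hom hφ)
    exact ⟨ModuleCat.ofHom ψ, ModuleCat.hom_ext hψ⟩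
  · intro h φ
    constructor
    · intro hφ
      have hφ' : P.complex.d (i + 2) (i + 1) ≫ ModuleCat.ofHom (Y := CharacterModule M) φ = 0 :=
        ModuleCat.hom_ext hφ
      obtain ⟨ψ, hψ⟩ := (P.extMk_eq_zero_iff _ (i + 2) rfl hφ' i rfl).mp (Subsingleton.elim _ _)
      exact ⟨ψ.hom, congrArg ModuleCat.Hom.hom hψ⟩
    · rintro ⟨ψ, rfl⟩
      have h0 := congrArg ModuleCat.Hom.hom (P.complex.d_comp_d (i + 2) (i + 1) i)
      have h1 := congrArg (LinearMap.comp ψ) h0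
      exact h1.trans (LinearMap.comp_zero ψ)

end CharacterDual

/-! ### Dimension shifting for vanishing Tor -/

section TorVanishing

open Abelian

/-- `Tor_i(Y, X) = 0` for all `i > n`, expressed through the dual groups
`Ext^i(X, CharacterModule Y)`. -/
def TorVanishesAbove (A : Type u) [CommRing A] (n : ℕ) (X Y : Type u) [AddCommGroup X] [Module A X]
    [AddCommGroup Y] [Module A Y] : Prop :=
  ∀ i, n < i → Subsingleton (Ext (ModuleCat.of A X) (ModuleCat.of A (CharacterModule Y)) i)

namespace TorVanishesAbove

variable {A : Type u} [CommRing A] {K F X Y : Type u} [AddCommGroup K] [Module A K]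
  [AddCommGroup F] [Module A F] [AddCommGroup X] [Module A X] [AddCommGroup Y] [Module A Y]
  {n : ℕ}

lemma mono {m : ℕ} (h : TorVanishesAbove A n X Y) (hnm : n ≤ m) : TorVanishesAbove A m X Y :=
  fun i hi ↦ h i (hnm.trans_lt hi)

lemma of_hasProjectiveDimensionLE (h : HasProjectiveDimensionLE (ModuleCat.of A X) n) :
    TorVanishesAbove A n X Y :=
  fun i hi ↦ HasProjectiveDimensionLT.subsingleton (ModuleCat.of A X) (n + 1) i (by omega) _

/-- The middle term is only required to be Tor-acyclic against `Y`: it will be free over an algebra,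
not over `A`. -/
lemma syzygy_left {f : K →ₗ[A] F} {g : F →ₗ[A] X} (hf : Function.Injective f)
    (hg : Function.Surjective g) (hfg : Function.Exact f g) (hF : TorVanishesAbove A 0 F Y)
    (hX : TorVanishesAbove A (n + 1) X Y) : TorVanishesAbove A n K Y := by
  intro i hi
  have hS := shortExact_of_exact hf hg hfg
  have h1 := hX (i + 1) (by omega)
  have h2 := hF i (by omega)
  refine subsingleton_of_forall_eq 0 fun x ↦ ?_
  obtain ⟨y, rfl⟩ := Ext.contravariant_sequence_exact₁ hS _ x (add_comm 1 i) (h1.elim _ _)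
  rw [h2.elim y 0, Ext.comp_zero]

lemma shortExact_dual {f : K →ₗ[A] F} {g : F →ₗ[A] X} (hf : Function.Injective f)
    (hg : Function.Surjective g) (hfg : Function.Exact f g) :
    (ShortComplex.mk (ModuleCat.ofHom (CharacterModule.dual g))
      (ModuleCat.ofHom (CharacterModule.dual f))
      (by
        ext1
        exact LinearMap.ext (CharacterModule.exact_dual hfg).apply_apply_eq_zero)).ShortExact :=
  shortExact_of_exact (CharacterModule.dual_injective_of_surjective g hg)
    (CharacterModule.dual_surjective_of_injective f hf) (CharacterModule.exact_dual hfg)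

lemma syzygy_right {f : K →ₗ[A] F} {g : F →ₗ[A] Y} (hf : Function.Injective f)
    (hg : Function.Surjective g) (hfg : Function.Exact f g) (hF : TorVanishesAbove A 0 X F)
    (hY : TorVanishesAbove A (n + 1) X Y) : TorVanishesAbove A n X K := by
  intro i hi
  have hS := shortExact_dual hf hg hfg
  have h1 := hY (i + 1) (by omega)
  have h2 := hF i (by omega)
  refine subsingleton_of_forall_eq 0 fun x ↦ ?_
  obtain ⟨y, rfl⟩ := Ext.covariant_sequence_exact₃ _ hS x rfl (h1.elim _ _)
  rw [h2.elim y 0, Ext.zero_comp]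

lemma pi_left (h : TorVanishesAbove A n X Y) (k : ℕ) : TorVanishesAbove A n (Fin k → X) Y := by
  intro i hi
  have h1 := h i hi
  refine subsingleton_of_forall_eq 0 fun x ↦ ?_
  have hid : 𝟙 (ModuleCat.of A (Fin k → X)) = ∑ j, ModuleCat.ofHom (LinearMap.proj j) ≫
      ModuleCat.ofHom (LinearMap.single A (fun _ : Fin k ↦ X) j) := by
    ext1
    refine LinearMap.ext fun y ↦ ?_
    simp [ModuleCat.hom_sum, LinearMap.sum_apply, Finset.univ_sum_single]
  rw [← Ext.mk₀_id_comp x, hid, Ext.mk₀_sum, Ext.sum_comp]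
  refine Finset.sum_eq_zero fun j _ ↦ ?_
  rw [← Ext.mk₀_comp_mk₀_assoc, h1.elim (Ext.comp _ x _) 0, Ext.comp_zero]

lemma pi_right (h : TorVanishesAbove A n X Y) (k : ℕ) : TorVanishesAbove A n X (Fin k → Y) := by
  intro i hi
  have h1 := h i hi
  refine subsingleton_of_forall_eq 0 fun x ↦ ?_
  have hid : 𝟙 (ModuleCat.of A (CharacterModule (Fin k → Y))) =
      ∑ j, ModuleCat.ofHom (CharacterModule.dual (LinearMap.single A (fun _ : Fin k ↦ Y) j)) ≫
        ModuleCat.ofHom (CharacterModule.dual (LinearMap.proj j)) := by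
    ext1
    refine LinearMap.ext fun (c : CharacterModule (Fin k → Y)) ↦ ?_
    rw [ModuleCat.hom_sum, LinearMap.sum_apply]
    refine DFunLike.ext (F := CharacterModule (Fin k → Y)) _ _ fun y ↦ ?_
    have hsum (e : Fin k → CharacterModule (Fin k → Y)) : (∑ j, e j) y = ∑ j, e j y :=
      map_sum (AddMonoidHom.mk' (fun e : CharacterModule (Fin k → Y) ↦ e y) fun _ _ ↦ rfl) e _
    refine Eq.trans ?_ (hsum _).symm
    refine Eq.trans ?_ (map_sum c (fun j ↦ Pi.single j (y j)) Finset.univ)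
    rw [Finset.univ_sum_single]
    rfl
  rw [← Ext.comp_mk₀_id x, hid, Ext.mk₀_sum, Ext.comp_sum]
  refine Finset.sum_eq_zero fun j _ ↦ ?_
  rw [← Ext.mk₀_comp_mk₀, ← Ext.comp_assoc_of_third_deg_zero, h1.elim (Ext.comp x _ _) 0,
    Ext.zero_comp]

lemma rTensor_injective {f : K →ₗ[A] F} {g : F →ₗ[A] X} (hf : Function.Injective f)
    (hg : Function.Surjective g) (hfg : Function.Exact f g) (h : TorVanishesAbove A 0 X Y) :
    Function.Injective (f.rTensor Y) := by
  rw [rTensor_injective_iff_lcomp_surjective]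
  intro φ
  have hS := shortExact_of_exact hf hg hfg
  have h1 := h 1 one_pos
  obtain ⟨y, hy⟩ := Ext.contravariant_sequence_exact₁ hS _ (Ext.mk₀ (ModuleCat.ofHom φ))
    (add_zero 1) (h1.elim _ _)
  obtain ⟨ψ, rfl⟩ := (Ext.mk₀_bijective _ _).2 y
  rw [Ext.mk₀_comp_mk₀] at hy
  exact ⟨ψ.hom, congrArg ModuleCat.Hom.hom ((Ext.mk₀_bijective _ _).1 hy)⟩

/-- Dually, a map X → K* lifts to F* because the obstruction lies in Ext¹(X, Y*) = 0. Treating each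
variable directly makes symmetry of Tor unnecessary. -/
lemma lTensor_injective {f : K →ₗ[A] F} {g : F →ₗ[A] Y} (hf : Function.Injective f)
    (hg : Function.Surjective g) (hfg : Function.Exact f g) (h : TorVanishesAbove A 0 X Y) :
    Function.Injective (f.lTensor X) := by
  rw [← CharacterModule.dual_surjective_iff_injective (R := A)]
  intro c
  have hS := shortExact_dual hf hg hfg
  have h1 := h 1 one_pos
  obtain ⟨y, hy⟩ := Ext.covariant_sequence_exact₃ _ hS
    (Ext.mk₀ (ModuleCat.ofHom (CharacterModule.curry c)))
    (zero_add 1) (h1.elim _ _)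
  obtain ⟨ψ, rfl⟩ := (Ext.mk₀_bijective _ _).2 y
  rw [Ext.mk₀_comp_mk₀] at hy
  have hψ := congrArg ModuleCat.Hom.hom ((Ext.mk₀_bijective _ _).1 hy)
  refine ⟨CharacterModule.uncurry ψ.hom, CharacterModule.homEquiv.symm.injective ?_⟩
  refine Eq.trans ?_ hψ
  ext x y
  rfl

lemma subsingleton_ext_one_of_lTensor_injective [Module.Projective A F] {f : K →ₗ[A] F}
    {g : F →ₗ[A] X} (hf : Function.Injective f)
    (hg : Function.Surjective g) (hfg : Function.Exact f g)
    (h : Function.Injective (f.lTensor Y)) :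
    Subsingleton (Ext (ModuleCat.of A X) (ModuleCat.of A (CharacterModule Y)) 1) := by
  have hS := shortExact_of_exact hf hg hfg
  have : Projective (ModuleCat.of A F) := (IsProjective.iff_projective F).mp inferInstance
  refine subsingleton_of_forall_eq 0 fun x ↦ ?_
  obtain ⟨y, rfl⟩ := Ext.contravariant_sequence_exact₃ hS _ x (Ext.eq_zero_of_projective _)
    (add_zero 1)
  obtain ⟨φ, rfl⟩ := (Ext.mk₀_bijective _ _).2 y
  rw [LinearMap.lTensor_inj_iff_rTensor_inj, rTensor_injective_iff_lcomp_surjective] at h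
  obtain ⟨ψ, hψ⟩ := h φ.hom
  have : φ = ModuleCat.ofHom f ≫ ModuleCat.ofHom ψ := ModuleCat.hom_ext hψ.symm
  rw [this, ← Ext.mk₀_comp_mk₀]
  exact hS.extClass_comp_assoc (Ext.mk₀ (ModuleCat.ofHom ψ))

lemma subsingleton_ext_succ [Module.Projective A F] {f : K →ₗ[A] F}
    {g : F →ₗ[A] X} (hf : Function.Injective f)
    (hg : Function.Surjective g) (hfg : Function.Exact f g) {Z : ModuleCat.{u} A}
    (h : Subsingleton (Ext (ModuleCat.of A K) Z n)) :
    Subsingleton (Ext (ModuleCat.of A X) Z (n + 1)) := by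
  have hS := shortExact_of_exact hf hg hfg
  have : Projective (ModuleCat.of A F) := (IsProjective.iff_projective F).mp inferInstance
  refine subsingleton_of_forall_eq 0 fun x ↦ ?_
  obtain ⟨y, rfl⟩ := Ext.contravariant_sequence_exact₃ hS _ x (Ext.eq_zero_of_projective _)
    (add_comm 1 n)
  rw [h.elim y 0, Ext.comp_zero]

end TorVanishesAbove

end TorVanishing

/-! ### Free resolutions as syzygy sequences, and their base change -/

lemma exact_linearEquiv_comp {A : Type*} [CommRing A] {K F F' M : Type*} [AddCommGroup K]
    [Module A K] [AddCommGroup F] [Module A F] [AddCommGroup F'] [Module A F'] [AddCommGroup M]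
    [Module A M] {f : K →ₗ[A] F} {g : F →ₗ[A] M} (h : Function.Exact f g) (e : F ≃ₗ[A] F') :
    Function.Exact (e.toLinearMap ∘ₗ f) (g ∘ₗ e.symm.toLinearMap) := by
  intro x
  obtain ⟨y, rfl⟩ := e.surjective x
  simpa using h y

/-- A resolution by finite free modules, cut into short exact sequences
`0 → X (j + 1) → A ^ rank j → X j → 0`. -/
structure SyzygySequence (A : Type u) [CommRing A] where
  X : ℕ → Type u
  [addCommGroup : ∀ j, AddCommGroup (X j)]
  [module : ∀ j, Module A (X j)]
  [finite : ∀ j, Module.Finite A (X j)]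
  rank : ℕ → ℕ
  incl : ∀ j, X (j + 1) →ₗ[A] (Fin (rank j) → A)
  proj : ∀ j, (Fin (rank j) → A) →ₗ[A] X j
  incl_injective : ∀ j, Function.Injective (incl j)
  proj_surjective : ∀ j, Function.Surjective (proj j)
  exact : ∀ j, Function.Exact (incl j) (proj j)

namespace SyzygySequence

attribute [instance] addCommGroup module finite

variable {A : Type u} [CommRing A]

/-- The sequence of higher syzygies, starting from the `d`-th. -/
def drop (S : SyzygySequence A) (d : ℕ) : SyzygySequence A where
  X j := S.X (d + j)
  rank j := S.rank (d + j)
  incl j := S.incl (d + j)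
  proj j := S.proj (d + j)
  incl_injective j := S.incl_injective (d + j)
  proj_surjective j := S.proj_surjective (d + j)
  exact j := S.exact (d + j)

lemma hasProjectiveDimensionLE_of_add (S : SyzygySequence A) {d n : ℕ}
    (h : HasProjectiveDimensionLE (ModuleCat.of A (S.X d)) n) :
    HasProjectiveDimensionLE (ModuleCat.of A (S.X 0)) (n + d) := by
  induction d generalizing n with
  | zero => exact h
  | succ d ih =>
    have := ih ((hasProjectiveDimensionLE_succ_iff_of_exact (S.incl_injective d)
      (S.proj_surjective d) (S.exact d) n).mpr h)
    rwa [add_right_comm] at this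

lemma exists_linearEquiv [IsNoetherianRing A] (M : Type u) [AddCommGroup M] [Module A M]
    [Module.Finite A M] : ∃ S : SyzygySequence A, Nonempty (S.X 0 ≃ₗ[A] M) := by
  let T := {N : ModuleCat.{u} A // Module.Finite A N}
  have hfin (N : T) : ∃ (n : ℕ) (f : (Fin n → A) →ₗ[A] N.1), Function.Surjective f :=
    have := N.2
    Module.Finite.exists_fin' A N.1
  choose r f hf using hfin
  let syz : T → T := fun N ↦ ⟨ModuleCat.of A (LinearMap.ker (f N)), inferInstanceAs
    (Module.Finite A (LinearMap.ker (f N)))⟩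
  let M₀ : T := ⟨ModuleCat.of A M, ‹_›⟩
  let X : ℕ → T := fun j ↦ j.rec M₀ fun _ ↦ syz
  have (j : ℕ) : Module.Finite A (X j).1 := (X j).2
  exact ⟨{  X := fun j ↦ (X j).1
            rank := fun j ↦ r (X j)
            incl := fun j ↦ (LinearMap.ker (f (X j))).subtype
            proj := fun j ↦ f (X j)
            incl_injective := fun j ↦ Submodule.injective_subtype _
            proj_surjective := fun j ↦ hf (X j)
            exact := fun j ↦ LinearMap.exact_subtype_ker_map (f (X j)) }, ⟨LinearEquiv.refl A M⟩⟩

section Shift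

variable {P : Type u} [CommRing P] [Algebra P A] (S : SyzygySequence A) [∀ j, Module P (S.X j)]
  [∀ j, IsScalarTower P A (S.X j)] {Y : Type u} [AddCommGroup Y] [Module P Y] {n d : ℕ}

lemma torVanishesAbove_left_add (hA : TorVanishesAbove P 0 A Y)
    (h : TorVanishesAbove P (n + d) (S.X 0) Y) : TorVanishesAbove P n (S.X d) Y := by
  induction d generalizing n with
  | zero => exact h
  | succ d ih =>
    exact TorVanishesAbove.syzygy_left (f := (S.incl d).restrictScalars P)
      (g := (S.proj d).restrictScalars P) (S.incl_injective d) (S.proj_surjective d) (S.exact d)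
      (hA.pi_left _) (ih (by rwa [add_right_comm, ← add_assoc] at *))

lemma torVanishesAbove_left (hA : TorVanishesAbove P 0 A Y) (h : TorVanishesAbove P n (S.X 0) Y)
    (hd : n ≤ d) : TorVanishesAbove P 0 (S.X d) Y :=
  S.torVanishesAbove_left_add hA ((zero_add d).symm ▸ h.mono hd)

lemma torVanishesAbove_right_add (hA : TorVanishesAbove P 0 Y A)
    (h : TorVanishesAbove P (n + d) Y (S.X 0)) : TorVanishesAbove P n Y (S.X d) := by
  induction d generalizing n with
  | zero => exact h
  | succ d ih =>
    exact TorVanishesAbove.syzygy_right (f := (S.incl d).restrictScalars P)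
      (g := (S.proj d).restrictScalars P) (S.incl_injective d) (S.proj_surjective d) (S.exact d)
      (hA.pi_right _) (ih (by rwa [add_right_comm, ← add_assoc] at *))

lemma torVanishesAbove_right (hA : TorVanishesAbove P 0 Y A) (h : TorVanishesAbove P n Y (S.X 0))
    (hd : n ≤ d) : TorVanishesAbove P 0 Y (S.X d) :=
  S.torVanishesAbove_right_add hA ((zero_add d).symm ▸ h.mono hd)

end Shift

lemma torVanishesAbove_of_lTensor_injective (S : SyzygySequence A) (M : Type u) [AddCommGroup M]
    [Module A M] (h : ∀ j, Function.Injective ((S.incl j).lTensor M)) :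
    TorVanishesAbove A 0 (S.X 0) M := by
  intro i hi
  obtain ⟨i, rfl⟩ := Nat.exists_eq_add_of_lt hi
  rw [zero_add]
  clear hi
  -- The induction on the degree moves on to the next syzygy, so the starting index must vary.
  generalize 0 = j
  induction i generalizing j with
  | zero =>
    exact TorVanishesAbove.subsingleton_ext_one_of_lTensor_injective (S.incl_injective j)
      (S.proj_surjective j) (S.exact j) (h j)
  | succ i ih =>
    exact TorVanishesAbove.subsingleton_ext_succ (S.incl_injective j)
      (S.proj_surjective j) (S.exact j) (ih (j + 1))

section BaseChange

variable (S : SyzygySequence A) (R : Type u) [CommRing R] [Algebra A R]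

/-- Base change of a sequence of syzygies whose exactness is preserved. -/
noncomputable def baseChange (h : ∀ j, Function.Injective ((S.incl j).lTensor R)) :
    SyzygySequence R where
  X j := R ⊗[A] S.X j
  rank := S.rank
  incl j := (TensorProduct.piScalarRight A R R (Fin (S.rank j))).toLinearMap ∘ₗ
    (S.incl j).baseChange R
  proj j := (S.proj j).baseChange R ∘ₗ
    (TensorProduct.piScalarRight A R R (Fin (S.rank j))).symm.toLinearMap
  incl_injective j := (TensorProduct.piScalarRight A R R (Fin (S.rank j))).injective.comp (h j)
  proj_surjective j := (LinearMap.lTensor_surjective R (S.proj_surjective j)).comp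
    (TensorProduct.piScalarRight A R R (Fin (S.rank j))).symm.surjective
  exact j := exact_linearEquiv_comp (f := (S.incl j).baseChange R) (g := (S.proj j).baseChange R)
    (lTensor_exact R (S.exact j) (S.proj_surjective j)) _

end BaseChange

end SyzygySequence

/-! ### Tensor identities for a pushout of rings -/

section TensorInjectivity

variable {P A B R : Type u} [CommRing P] [CommRing A] [CommRing B] [CommRing R] [Algebra P A]
  [Algebra P B] [Algebra P R] [Algebra A R] [Algebra B R] [IsScalarTower P A R]
  [IsScalarTower P B R]

lemma injective_of_equiv_comm {X Y X' Y' : Type*} {f : X → Y} {g : X' → Y'} (e : X ≃ X')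
    (e' : Y ≃ Y') (h : ∀ x, e' (f x) = g (e x)) (hg : Function.Injective g) :
    Function.Injective f := by
  have : e' ∘ f = g ∘ e := funext h
  exact (this ▸ hg.comp e.injective).of_comp

lemma lTensor_injective_of_isPushout [Algebra.IsPushout P B A R] {X X' : Type u}
    [AddCommGroup X] [Module A X] [Module P X] [IsScalarTower P A X] [AddCommGroup X'] [Module A X']
    [Module P X'] [IsScalarTower P A X'] (f : X →ₗ[A] X')
    (h : Function.Injective ((f.restrictScalars P).lTensor B)) :
    Function.Injective (f.lTensor R) := by
  refine injective_of_equiv_comm (Algebra.IsPushout.cancelBaseChange P B A R X).toEquiv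
    (Algebra.IsPushout.cancelBaseChange P B A R X').toEquiv (fun x ↦ ?_) h
  obtain ⟨x, rfl⟩ := (Algebra.IsPushout.cancelBaseChange P B A R X).symm.surjective x
  change Algebra.IsPushout.cancelBaseChange P B A R X' _ =
    (f.restrictScalars P).lTensor B (Algebra.IsPushout.cancelBaseChange P B A R X _)
  rw [LinearEquiv.apply_symm_apply, ← LinearEquiv.eq_symm_apply]
  induction x with
  | zero => simp
  | add x y hx hy => simp only [map_add, hx, hy]
  | tmul b x => simp

/-- Rests on (R ⊗_A X) ⊗_R (R ⊗_B Y) ≅ X ⊗_P Y, natural in Y. -/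
lemma lTensor_baseChange_injective_of_isPushout [Algebra.IsPushout P B A R] (X : Type u)
    {Y Y' : Type u} [AddCommGroup X] [Module A X] [Module P X] [IsScalarTower P A X]
    [AddCommGroup Y] [Module B Y] [Module P Y] [IsScalarTower P B Y]
    [AddCommGroup Y'] [Module B Y'] [Module P Y'] [IsScalarTower P B Y'] (f : Y →ₗ[B] Y')
    (h : Function.Injective ((f.restrictScalars P).lTensor X)) :
    Function.Injective ((f.baseChange R).lTensor (R ⊗[A] X)) := by
  have h1 : Function.Injective (f.lTensor (B ⊗[P] X)) := by
    rw [LinearMap.lTensor_inj_iff_rTensor_inj] at h ⊢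
    refine injective_of_equiv_comm
      (AlgebraTensorModule.cancelBaseChange P B B Y X).toEquiv
      (AlgebraTensorModule.cancelBaseChange P B B Y' X).toEquiv (fun x ↦ ?_) h
    change AlgebraTensorModule.cancelBaseChange P B B Y' X _ =
      (f.restrictScalars P).rTensor X (AlgebraTensorModule.cancelBaseChange P B B Y X x)
    induction x with
    | zero => simp
    | add x y hx hy => simp only [map_add, hx, hy]
    | tmul y z =>
      induction z with
      | zero => simp
      | add x y hx hy => simp only [map_add, tmul_add, hx, hy]
      | tmul b x => simp
  have h2 : Function.Injective (f.lTensor (R ⊗[A] X)) := by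
    let e := Algebra.IsPushout.cancelBaseChange P B A R X
    refine injective_of_equiv_comm (TensorProduct.congr e (LinearEquiv.refl B Y)).toEquiv
      (TensorProduct.congr e (LinearEquiv.refl B Y')).toEquiv (fun x ↦ ?_) h1
    change TensorProduct.congr e (LinearEquiv.refl B Y') _ =
      f.lTensor _ (TensorProduct.congr e (LinearEquiv.refl B Y) x)
    induction x with
    | zero => simp
    | add x y hx hy => simp only [map_add, hx, hy]
    | tmul y z => simp
  refine injective_of_equiv_comm
    (AlgebraTensorModule.cancelBaseChange B R R (R ⊗[A] X) Y).toEquiv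
    (AlgebraTensorModule.cancelBaseChange B R R (R ⊗[A] X) Y').toEquiv (fun x ↦ ?_) h2
  change AlgebraTensorModule.cancelBaseChange B R R (R ⊗[A] X) Y' _ =
    f.lTensor _ (AlgebraTensorModule.cancelBaseChange B R R (R ⊗[A] X) Y x)
  induction x with
  | zero => simp
  | add x y hx hy => simp only [map_add, hx, hy]
  | tmul y z =>
    induction z with
    | zero => simp
    | add x y hx hy => simp only [map_add, tmul_add, hx, hy]
    | tmul b x => simp

end TensorInjectivity

/-! ### Descent of projective dimension along a local homomorphism -/

section Descent

variable {A R : Type u} [CommRing A] [CommRing R] [Algebra A R] [IsLocalRing A]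
  [IsLocalRing R] [IsLocalHom (algebraMap A R)]

lemma lTensor_residueField_injective_of_residueField {X X' : Type u} [AddCommGroup X] [Module A X]
    [AddCommGroup X'] [Module A X'] (f : X →ₗ[A] X')
    (h : Function.Injective (f.lTensor (ResidueField R))) :
    Function.Injective (f.lTensor (ResidueField A)) := by
  let i : ResidueField A →ₗ[A] ResidueField R :=
    (Algebra.linearMap (ResidueField A) (ResidueField R)).restrictScalars A
  have hi : Function.Injective (i.rTensor X) := by
    obtain ⟨l, hl⟩ := LinearMap.exists_leftInverse_of_injective
      (Algebra.linearMap (ResidueField A) (ResidueField R))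
      (LinearMap.ker_eq_bot.mpr (algebraMap (ResidueField A) (ResidueField R)).injective)
    have : (l.restrictScalars A).rTensor X ∘ₗ i.rTensor X = LinearMap.id := by
      rw [← LinearMap.rTensor_comp, ← LinearMap.rTensor_id]
      congr 1
      exact LinearMap.ext fun x ↦ LinearMap.congr_fun hl x
    exact Function.HasLeftInverse.injective ⟨_, LinearMap.congr_fun this⟩
  have hcomm : f.lTensor (ResidueField R) ∘ₗ i.rTensor X =
      i.rTensor X' ∘ₗ f.lTensor (ResidueField A) := by
    rw [LinearMap.lTensor_comp_rTensor, LinearMap.rTensor_comp_lTensor]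
  have : Function.Injective (i.rTensor X' ∘ₗ f.lTensor (ResidueField A)) := by
    rw [← hcomm]
    exact h.comp hi
  exact Function.Injective.of_comp this

/-- Over `R` the sequence splits, so `f` stays injective over the residue field of `R`, hence over
that of `A`. For a map of finite modules into a free one over a local ring, this already gives a
splitting. -/
lemma projective_of_projective_baseChange {K F X : Type u} [AddCommGroup K] [Module A K]
    [Module.Finite A K] [AddCommGroup F] [Module A F] [Module.Free A F] [Module.Finite A F]
    [AddCommGroup X] [Module A X] {f : K →ₗ[A] F} {g : F →ₗ[A] X}
    (hg : Function.Surjective g) (hfg : Function.Exact f g)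
    (hR : Function.Injective (f.lTensor R)) [Module.Projective R (R ⊗[A] X)] :
    Module.Projective A X := by
  have hexR : Function.Exact (f.baseChange R) (g.baseChange R) := lTensor_exact R hfg hg
  obtain ⟨s, hs⟩ := Module.projective_lifting_property (g.baseChange R) LinearMap.id
    (LinearMap.lTensor_surjective R hg)
  have hs' : Function.Injective (f.baseChange R) ∧ ∃ l, g.baseChange R ∘ₗ l = LinearMap.id :=
    ⟨hR, s, hs⟩
  obtain ⟨-, l, hl⟩ := (hexR.split_tfae'.out 0 1).mp hs'
  have hκ : Function.Injective ((f.baseChange R).lTensor (ResidueField R)) := by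
    have : l.lTensor (ResidueField R) ∘ₗ (f.baseChange R).lTensor (ResidueField R) = .id := by
      rw [← LinearMap.lTensor_comp, hl, LinearMap.lTensor_id]
    exact Function.HasLeftInverse.injective ⟨_, LinearMap.congr_fun this⟩
  have hκ' : Function.Injective (f.lTensor (ResidueField R)) := by
    refine injective_of_equiv_comm
      (AlgebraTensorModule.cancelBaseChange A R R (ResidueField R) K).symm.toEquiv
      (AlgebraTensorModule.cancelBaseChange A R R (ResidueField R) F).symm.toEquiv (fun x ↦ ?_) hκ
    change (AlgebraTensorModule.cancelBaseChange A R R (ResidueField R) F).symm _ =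
      (f.baseChange R).lTensor _
        ((AlgebraTensorModule.cancelBaseChange A R R (ResidueField R) K).symm x)
    induction x with
    | zero => simp
    | add x y hx hy => simp only [map_add, hx, hy]
    | tmul y z => simp
  obtain ⟨l', hl'⟩ := (IsLocalRing.split_injective_iff_lTensor_residueField_injective f).mpr
    (lTensor_residueField_injective_of_residueField f hκ')
  have hl'' : Function.Surjective g ∧ ∃ l, l ∘ₗ f = LinearMap.id := ⟨hg, l', hl'⟩
  obtain ⟨-, s', hs'⟩ := (hfg.split_tfae'.out 1 0).mp hl''
  exact Module.Projective.of_split s' g hs'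

lemma SyzygySequence.hasProjectiveDimensionLE_of_baseChange (S : SyzygySequence A)
    (h : ∀ j, Function.Injective ((S.incl j).lTensor R)) {n : ℕ} (j : ℕ)
    (hn : HasProjectiveDimensionLE (ModuleCat.of R (R ⊗[A] S.X j)) n) :
    HasProjectiveDimensionLE (ModuleCat.of A (S.X j)) n := by
  induction n generalizing j with
  | zero =>
    rw [hasProjectiveDimensionLE_zero_iff_projective] at hn ⊢
    exact projective_of_projective_baseChange (S.proj_surjective j) (S.exact j) (h j)
  | succ n ih =>
    rw [hasProjectiveDimensionLE_succ_iff_of_exact (S.incl_injective j) (S.proj_surjective j)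
      (S.exact j)]
    refine ih (j + 1) ((hasProjectiveDimensionLE_succ_iff_of_exact
      ((S.baseChange R h).incl_injective j) ((S.baseChange R h).proj_surjective j)
      ((S.baseChange R h).exact j) n).mp hn)

end Descent

/-! ### Construction of the Tor-independent pair -/

lemma IsRegularLocalRing.exists_torVanishesAbove (P : Type u) [CommRing P] [IsRegularLocalRing P]
    (X : Type u) [AddCommGroup X] [Module P X] [Module.Finite P X] :
    ∃ n, ∀ (Y : Type u) [AddCommGroup Y] [Module P Y], TorVanishesAbove P n X Y := by
  obtain ⟨n, hn⟩ := exists_hasProjectiveDimensionLE P X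
  exact ⟨n, fun Y _ _ ↦ .of_hasProjectiveDimensionLE hn⟩

/-- Modules obtained by base change from a pair of syzygy sequences over Tor-independent algebras
`A` and `B` are Tor-independent. -/
lemma torVanishesAbove_baseChange {P A B R : Type u} [CommRing P] [CommRing A] [CommRing B]
    [CommRing R] [Algebra P A] [Algebra P B] [Algebra P R] [Algebra A R] [Algebra B R]
    [IsScalarTower P A R] [IsScalarTower P B R] [Algebra.IsPushout P B A R]
    (X : Type u) [AddCommGroup X] [Module A X] [Module P X] [IsScalarTower P A X]
    (S : SyzygySequence B) [∀ j, Module P (S.X j)] [∀ j, IsScalarTower P B (S.X j)]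
    (hS : ∀ j, TorVanishesAbove P 0 X (S.X j))
    (hR : ∀ j, Function.Injective ((S.incl j).lTensor R)) :
    TorVanishesAbove R 0 (R ⊗[B] S.X 0) (R ⊗[A] X) := by
  refine (S.baseChange R hR).torVanishesAbove_of_lTensor_injective _ fun j ↦ ?_
  have hj : Function.Injective (((S.incl j).baseChange R).lTensor (R ⊗[A] X)) :=
    lTensor_baseChange_injective_of_isPushout (P := P) X (S.incl j)
      (TorVanishesAbove.lTensor_injective (f := (S.incl j).restrictScalars P)
        (g := (S.proj j).restrictScalars P) (S.incl_injective j) (S.proj_surjective j) (S.exact j)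
        (hS j))
  change Function.Injective (LinearMap.lTensor (R ⊗[A] X)
    ((TensorProduct.piScalarRight B R R (Fin (S.rank j))).toLinearMap ∘ₗ
      (S.incl j).baseChange R))
  rw [LinearMap.lTensor_comp]
  exact (LinearEquiv.lTensor (R ⊗[A] X)
    (TensorProduct.piScalarRight B R R (Fin (S.rank j)))).injective.comp hj

lemma IsLocalRing.nonempty_algHom_residueField {P Q : Type*} [CommRing P] [IsLocalRing P]
    [CommRing Q] [Algebra P Q] [Nontrivial Q] (hQ : Function.Surjective (algebraMap P Q)) :
    Nonempty (Q →ₐ[P] ResidueField P) := by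
  refine ⟨AlgHom.liftOfSurjective (Algebra.ofId P Q) hQ (Algebra.ofId P (ResidueField P)) ?_⟩
  intro x hx
  exact (residue_eq_zero_iff x).mpr
    (le_maximalIdeal (RingHom.ker_ne_top (algebraMap P Q)) hx)

lemma TensorProduct.nontrivial_of_surjective {P Q Q' : Type*} [CommRing P] [IsLocalRing P]
    [CommRing Q] [Algebra P Q] [CommRing Q'] [Algebra P Q'] [Nontrivial Q] [Nontrivial Q']
    (hQ : Function.Surjective (algebraMap P Q)) (hQ' : Function.Surjective (algebraMap P Q')) :
    Nontrivial (Q ⊗[P] Q') := by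
  obtain ⟨f⟩ := nonempty_algHom_residueField hQ
  obtain ⟨g⟩ := nonempty_algHom_residueField hQ'
  exact (Algebra.TensorProduct.lift f g fun _ _ ↦ .all _ _).toRingHom.domain_nontrivial

theorem not_isTorFriendly_of_isPushout {P A B R : Type u} [CommRing P] [IsRegularLocalRing P]
    [CommRing A] [CommRing B]
    [CommRing R] [Algebra P A] [Algebra P B] [Algebra P R] [Algebra A R] [Algebra B R]
    [IsScalarTower P A R] [IsScalarTower P B R] [Algebra.IsPushout P B A R]
    [IsLocalRing A] [IsLocalRing B] [IsLocalRing R] [IsLocalHom (algebraMap A R)]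
    [IsLocalHom (algebraMap B R)] (hA : Function.Surjective (algebraMap P A))
    (hB : Function.Surjective (algebraMap P B)) (hAsing : ¬ IsRegularLocalRing A)
    (hBsing : ¬ IsRegularLocalRing B) (hAB : TorVanishesAbove P 0 A B) :
    ¬ IsTorFriendly R := by
  have : Algebra.IsPushout P A B R := .symm inferInstance
  have : IsNoetherianRing A := isNoetherianRing_of_surjective P A _ hA
  have : IsNoetherianRing B := isNoetherianRing_of_surjective P B _ hB
  have : Module.Finite P A := .of_surjective (Algebra.linearMap P A) hA
  have : Module.Finite P B := .of_surjective (Algebra.linearMap P B) hB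
  obtain ⟨S, ⟨eS⟩⟩ := SyzygySequence.exists_linearEquiv (A := A) (ResidueField A)
  obtain ⟨T, ⟨eT⟩⟩ := SyzygySequence.exists_linearEquiv (A := B) (ResidueField B)
  let (j : ℕ) : Module P (S.X j) := Module.compHom _ (algebraMap P A)
  have (j : ℕ) : IsScalarTower P A (S.X j) := ⟨fun p a x ↦ by
    rw [Algebra.smul_def, mul_smul]; rfl⟩
  let (j : ℕ) : Module P (T.X j) := Module.compHom _ (algebraMap P B)
  have (j : ℕ) : IsScalarTower P B (T.X j) := ⟨fun p a x ↦ by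
    rw [Algebra.smul_def, mul_smul]; rfl⟩
  have (j : ℕ) : Module.Finite P (S.X j) := .trans A _
  obtain ⟨a, ha⟩ := IsRegularLocalRing.exists_torVanishesAbove P (S.X 0)
  have hS (j : ℕ) : TorVanishesAbove P 0 (S.X (a + j)) B :=
    S.torVanishesAbove_left hAB (ha B) (Nat.le_add_right a j)
  obtain ⟨b₁, hb₁⟩ := IsRegularLocalRing.exists_torVanishesAbove P A
  obtain ⟨b₂, hb₂⟩ := IsRegularLocalRing.exists_torVanishesAbove P (S.X a)
  -- `b` must serve two first arguments, `A` and `S.X a`, so it is chosen after `a`. The bounds do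
  -- not depend on the second argument.
  let b := max b₁ b₂
  have hT₁ (j : ℕ) : TorVanishesAbove P 0 A (T.X (b + j)) :=
    T.torVanishesAbove_right hAB (hb₁ _) (by omega)
  have hT₂ (j : ℕ) : TorVanishesAbove P 0 (S.X a) (T.X (b + j)) :=
    T.torVanishesAbove_right (hS 0) (hb₂ _) (by omega)
  have hSR (j : ℕ) : Function.Injective (((S.drop a).incl j).lTensor R) :=
    lTensor_injective_of_isPushout (P := P) (B := B) (S.incl (a + j))
      ((LinearMap.lTensor_inj_iff_rTensor_inj _ _).mpr
        (TorVanishesAbove.rTensor_injective (f := (S.incl (a + j)).restrictScalars P)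
          (g := (S.proj (a + j)).restrictScalars P) (S.incl_injective _) (S.proj_surjective _)
          (S.exact _) (hS j)))
  have hTR (j : ℕ) : Function.Injective (((T.drop b).incl j).lTensor R) :=
    lTensor_injective_of_isPushout (P := P) (B := A) (T.incl (b + j))
      (TorVanishesAbove.lTensor_injective (f := (T.incl (b + j)).restrictScalars P)
          (g := (T.proj (b + j)).restrictScalars P) (T.incl_injective _) (T.proj_surjective _)
          (T.exact _) (hT₁ j))
  have hpdS : ¬ projectiveDimension (ModuleCat.of R (R ⊗[A] S.X a)) < ⊤ := by
    intro h
    obtain ⟨n, hn⟩ := (projectiveDimension_ne_top_iff _).mp h.ne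
    have h1 := (S.drop a).hasProjectiveDimensionLE_of_baseChange hSR 0 hn
    exact hAsing (.of_hasProjectiveDimensionLE_residueField A
      ((hasProjectiveDimensionLE_of_equiv eS _).mp (S.hasProjectiveDimensionLE_of_add h1)))
  have hpdT : ¬ projectiveDimension (ModuleCat.of R (R ⊗[B] T.X b)) < ⊤ := by
    intro h
    obtain ⟨n, hn⟩ := (projectiveDimension_ne_top_iff _).mp h.ne
    have h1 := (T.drop b).hasProjectiveDimensionLE_of_baseChange hTR 0 hn
    exact hBsing (.of_hasProjectiveDimensionLE_residueField B
      ((hasProjectiveDimensionLE_of_equiv eT _).mp (T.hasProjectiveDimensionLE_of_add h1)))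
  intro hR
  let (j : ℕ) : Module P ((T.drop b).X j) := inferInstanceAs (Module P (T.X (b + j)))
  have (j : ℕ) : IsScalarTower P B ((T.drop b).X j) :=
    inferInstanceAs (IsScalarTower P B (T.X (b + j)))
  have hvan : TorVanishesAbove R 0 (R ⊗[B] T.X b) (R ⊗[A] S.X a) :=
    torVanishesAbove_baseChange (P := P) (S.X a) (T.drop b) hT₂ hTR
  refine (hR (R ⊗[A] S.X a) (R ⊗[B] T.X b) ⟨1, fun i hi ↦ ?_⟩).elim hpdS hpdT
  obtain ⟨i, rfl⟩ := Nat.exists_eq_add_of_le' hi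
  exact (isZero_Tor_succ_iff_subsingleton_ext _ _ _).mpr (hvan (i + 1) (by omega))

theorem proposition3p3 (P : Type u) [CommRing P] [IsRegularLocalRing P]
    (Q : Type u) [CommRing Q] [Algebra P Q] (hQ : Function.Surjective (algebraMap P Q))
    (Q' : Type u) [CommRing Q'] [Algebra P Q'] (hQ' : Function.Surjective (algebraMap P Q'))
    [IsLocalRing Q] (hQsing : ¬ IsRegularLocalRing Q)
    [IsLocalRing Q'] (hQsing' : ¬ IsRegularLocalRing Q')
    (hTor : ∀ i : ℕ, 1 ≤ i →
      Limits.IsZero (((Tor (ModuleCat.{u} P) i).obj (ModuleCat.of P Q)).obj (ModuleCat.of P Q'))) :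
    ¬ IsTorFriendly (TensorProduct P Q Q') := by
  let : Algebra Q' (Q ⊗[P] Q') := Algebra.TensorProduct.rightAlgebra
  have hsurjQ : Function.Surjective (algebraMap Q (Q ⊗[P] Q')) :=
    Algebra.TensorProduct.includeLeft_surjective (S := P) _ hQ'
  have hsurjQ' : Function.Surjective (algebraMap Q' (Q ⊗[P] Q')) :=
    Algebra.TensorProduct.includeRight_surjective _ hQ
  have := TensorProduct.nontrivial_of_surjective hQ hQ'
  have : IsLocalRing (Q ⊗[P] Q') := .of_surjective' _ hsurjQ
  have := IsLocalHom.of_surjective _ hsurjQ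
  have := IsLocalHom.of_surjective _ hsurjQ'
  have hvan : TorVanishesAbove P 0 Q' Q := by
    intro i hi
    obtain ⟨i, rfl⟩ := Nat.exists_eq_add_of_lt hi
    exact (isZero_Tor_succ_iff_subsingleton_ext _ _ _).mp (hTor _ (by omega))
  -- The roles are exchanged because Tor(Q, Q') is dual to Ext(Q', Q*).
  exact not_isTorFriendly_of_isPushout (P := P) (A := Q') (B := Q) hQ' hQ hQsing' hQsing hvan
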